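/- All digraphs are finite and have no loops and no parallel arcs. A digon is a pair of opposite arcs linking the same two vertices; a tournament is a digraph without digons in which any two distinct vertices are linked by an arc. A digraph is acyclic if it contains no directed cycle (of length at least $2$). A $k$-dicolouring of a digraph $D$ is a map $\phi: V(D)\to\{1,\dots,k\}$ such that each $\phi^{-1}(i)$ induces an acyclic subdigraph of $D$, and $D$ is $k$-dicolourable if it has a $k$-dicolouring. A digraph is $3$-dicritical if it is not $2$-dicolourable, but each of its proper subdigraphs (obtained by deleting vertices and/or arcs, at least one in total) is $2$-dicolourable. Let $\vec{C_3}$ be the directed triangle. Let $\mathcal{R}(\vec{C_3},\vec{C_3})$ be the tournament on seven vertices that consists of two disjoint directed triangles $T_1,T_2$ and one further vertex $r$, together with all arcs from $r$ to $T_1$, all arcs from $T_1$ to $T_2$ and all arcs from $T_2$ to $r$. Let $\mathcal{P}_7$ be the Paley tournament on seven vertices: its vertex set is $\mathbb{Z}/7\mathbb{Z}$, and there is an arc from $i$ to $j$ if and only if $j-i$ is a nonzero square modulo $7$, that is, $j-i\in\{1,2,4\}$. **Corollary.** Up to isomorphism there are exactly two $3$-dicritical tournaments, namely $\mathcal{R}(\vec{C_3},\vec{C_3})$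 and $\mathcal{P}_7$. That is, $\mathcal{R}(\vec{C_3},\vec{C_3})$ and $\mathcal{P}_7$ are $3$-dicritical tournaments, they are not isomorphic, and every $3$-dicritical tournament is isomorphic to one of them. -/

import Mathlib

namespace Digraph

universe u v

/-- `D` has no loop. Digraphs in the sense of graph theory (no loops, no parallel arcs) are the
terms of `Digraph V` with this property. -/
def Loopless {V : Type u} (D : Digraph V) : Prop :=
  ∀ x, ¬ D.Adj x x

/-- A digraph is semi-complete if any two distinct vertices are linked by at least one arc. -/
def IsSemicomplete {V : Type u} (D : Digraph V) : Prop :=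
  D.Loopless ∧ ∀ x y, x ≠ y → D.Adj x y ∨ D.Adj y x

/-- A digon is a pair of opposite arcs linking the same two (distinct) vertices. -/
def HasDigon {V : Type u} (D : Digraph V) : Prop :=
  ∃ x y, x ≠ y ∧ D.Adj x y ∧ D.Adj y x

/-- A tournament is a semi-complete digraph with no digon. -/
def IsTournament {V : Type u} (D : Digraph V) : Prop :=
  D.IsSemicomplete ∧ ¬ D.HasDigon

/-- An isomorphism of digraphs: a bijection of the vertices that preserves and reflects arcs. -/
abbrev Iso {V : Type u} {W : Type v} (D : Digraph V) (E : Digraph W) : Type (max u v) :=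
  D.Adj ≃r E.Adj

/-- The directed cycle with `n` vertices (used for `2 ≤ n`), with arcs from `i` to `i + 1`
modulo `n`. -/
def directedCycle (n : ℕ) : Digraph (ZMod n) where
  Adj i j := j = i + 1

/-- A digraph is acyclic if it contains no directed cycle on `n ≥ 2` vertices
as a (not necessarily induced) subdigraph. -/
def IsAcyclic {V : Type u} (D : Digraph V) : Prop :=
  ∀ n : ℕ, 2 ≤ n → ¬ ∃ c : ZMod n → V, Function.Injective c ∧
    ∀ i j, (directedCycle n).Adj i j → D.Adj (c i) (c j)

/-- The subdigraph of `D` induced by the vertex set `S`. -/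
def induce {V : Type u} (D : Digraph V) (S : Set V) : Digraph S where
  Adj x y := D.Adj x y

/-- A subdigraph of `D`: a set of vertices and a set of arcs of `D` between these vertices. -/
structure Subdigraph {V : Type u} (D : Digraph V) where
  verts : Set V
  Adj : V → V → Prop
  adj_sub : ∀ {x y}, Adj x y → D.Adj x y
  fst_mem : ∀ {x y}, Adj x y → x ∈ verts
  snd_mem : ∀ {x y}, Adj x y → y ∈ verts

/-- A subdigraph seen as a digraph on its own vertex set. -/
def Subdigraph.coe {V : Type u} {D : Digraph V} (H : D.Subdigraph) : Digraph H.verts where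
  Adj x y := H.Adj x y

/-- A subdigraph of `D` is proper if it misses at least one vertex or at least one arc of `D`. -/
def Subdigraph.IsProper {V : Type u} {D : Digraph V} (H : D.Subdigraph) : Prop :=
  H.verts ≠ Set.univ ∨ H.Adj ≠ D.Adj

/-- A `k`-dicolouring is a partition of the vertices into `k` (possibly empty) colour classes,
each of which induces an acyclic subdigraph. -/
def IsDicolouring {V : Type u} (D : Digraph V) {k : ℕ} (φ : V → Fin k) : Prop :=
  ∀ i, (D.induce (φ ⁻¹' {i})).IsAcyclic

/-- `D` is `k`-dicolourable if it has a `k`-dicolouring. -/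
def Dicolourable {V : Type u} (D : Digraph V) (k : ℕ) : Prop :=
  ∃ φ : V → Fin k, D.IsDicolouring φ

/-- For `k ≥ 1`, a digraph is `k`-dicritical if it is not `(k - 1)`-dicolourable, but all its
proper subdigraphs are. -/
def IsDicritical {V : Type u} (D : Digraph V) (k : ℕ) : Prop :=
  1 ≤ k ∧ ¬ D.Dicolourable (k - 1) ∧
    ∀ H : D.Subdigraph, H.IsProper → H.coe.Dicolourable (k - 1)

/-- The arcs of the rotative digraph `rotative H₁ H₂`: the arcs of `H₁` and of `H₂`, all arcs from
the additional vertex `none` to `H₁`, all arcs from `H₁` to `H₂`, and all arcs from `H₂` to the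
additional vertex. -/
inductive RotativeAdj {V : Type u} {W : Type v} (H₁ : Digraph V) (H₂ : Digraph W) :
    Option (V ⊕ W) → Option (V ⊕ W) → Prop
  | left {x y : V} : H₁.Adj x y → RotativeAdj H₁ H₂ (some (Sum.inl x)) (some (Sum.inl y))
  | right {x y : W} : H₂.Adj x y → RotativeAdj H₁ H₂ (some (Sum.inr x)) (some (Sum.inr y))
  | root_left (x : V) : RotativeAdj H₁ H₂ none (some (Sum.inl x))
  | left_right (x : V) (y : W) : RotativeAdj H₁ H₂ (some (Sum.inl x)) (some (Sum.inr y))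
  | right_root (y : W) : RotativeAdj H₁ H₂ (some (Sum.inr y)) none

/-- The rotative digraph `R(H₁, H₂)`, on disjoint copies of `H₁` and `H₂` and one more vertex. -/
def rotative {V : Type u} {W : Type v} (H₁ : Digraph V) (H₂ : Digraph W) :
    Digraph (Option (V ⊕ W)) where
  Adj := RotativeAdj H₁ H₂

/-- The Paley tournament on seven vertices: there is an arc from `i` to `j` if and only if `j - i`
is a nonzero square modulo `7`. -/
def paleySeven : Digraph (ZMod 7) where
  Adj i j := j - i ≠ 0 ∧ IsSquare (j - i)

end Digraph

/-!
In a tournament, a set of vertices is acyclic if and only if it contains no directed triangle. Thus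
a 2-dicolouring of a tournament is a two-colouring that splits every directed triangle.

Let `D` be a 3-dicritical tournament with an arc from `u` to `v`. A dicolouring of `D` without this
arc gives `u`, `v` and some vertex `w` the same colour, where `u v w` is a directed triangle, and it
splits all triangles of the tournament in which the arc is reversed
(`Digraph.IsDicritical.exists_colouring_reverseArc`). The existence of such a colouring passes to
subtournaments, and there are few tournaments that have one for every arc; call these viable.

The classification enumerates the viable tournaments that `D` must contain, by the number `m` of
their vertices. Let `S` be one of them, occurring in `D`. If some arc of `S` has no colouring as
above with `w` in `S`, the vertex `w` that `D` provides for this arc lies outside `S`, and extends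
`S` to a viable tournament on `m + 1` vertices. If there is no such arc and `S` is 2-dicolourable,
then `S` is not all of `D`, and any further vertex extends `S`
(`TournamentCode.IsCopy.exists_mem_extensions`). Up to isomorphism there are 1, 1, 1, 1, 3, 4, 15
tournaments to be considered for `m = 0, …, 6`. All those that arise for `m = 7` are
2-dicolourable apart from `R(C₃, C₃)` and `P₇`, and none arises for `m = 8`
(`TournamentCode.exhausted_eight`). Hence `D` contains `R(C₃, C₃)` or `P₇`. As these are not
2-dicolourable and `D` is critical, `D` has no further vertex.

Conversely, a tournament that is not 2-dicolourable is 3-dicritical as soon as the reversal of any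
of its arcs makes it 2-dicolourable (`Digraph.IsTournament.isDicritical`), which is a finite check.
-/

/-! ### Colourings of tournaments and criticality -/

namespace Digraph

universe u v

section Cycles

variable {V : Type u} {W : Type v} {D : Digraph V} {E : Digraph W}

theorem IsAcyclic.not_adj_of_triangle (h : D.IsAcyclic) (hl : D.Loopless) {x y z : V}
    (hxy : D.Adj x y) (hyz : D.Adj y z) : ¬ D.Adj z x := by
  intro hzx
  have h1 : x ≠ y := by rintro rfl; exact hl _ hxy
  have h2 : y ≠ z := by rintro rfl; exact hl _ hyz
  have h3 : z ≠ x := by rintro rfl; exact hl _ hzx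
  refine h 3 (by norm_num) ⟨fun i : Fin 3 => ![x, y, z] i, ?_, ?_⟩
  · intro i j hij
    change Fin 3 at i j
    fin_cases i <;> fin_cases j <;> first | rfl | simp_all
  · intro i j hij
    change j = i + 1 at hij
    subst hij
    change Fin 3 at i
    fin_cases i <;> assumption

theorem IsAcyclic.not_adj_of_quadrangle (h : D.IsAcyclic) (hl : D.Loopless) {x y z w : V}
    (hxz : x ≠ z) (hyw : y ≠ w) (hxy : D.Adj x y) (hyz : D.Adj y z) (hzw : D.Adj z w) :
    ¬ D.Adj w x := by
  intro hwx
  have h1 : x ≠ y := by rintro rfl; exact hl _ hxy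
  have h2 : y ≠ z := by rintro rfl; exact hl _ hyz
  have h3 : z ≠ w := by rintro rfl; exact hl _ hzw
  have h4 : w ≠ x := by rintro rfl; exact hl _ hwx
  refine h 4 (by norm_num) ⟨fun i : Fin 4 => ![x, y, z, w] i, ?_, ?_⟩
  · intro i j hij
    change Fin 4 at i j
    fin_cases i <;> fin_cases j <;> first | rfl | simp_all
  · intro i j hij
    change j = i + 1 at hij
    subst hij
    change Fin 4 at i
    fin_cases i <;> assumption

theorem isAcyclic_of_trans (hl : D.Loopless)
    (ht : ∀ x y z, D.Adj x y → D.Adj y z → D.Adj x z) : D.IsAcyclic := by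
  rintro n hn ⟨c, -, hc⟩
  have key : ∀ k : ℕ, D.Adj (c 0) (c ((k + 1 : ℕ) : ZMod n)) := by
    intro k
    induction k with
    | zero => exact hc _ _ (by simp [directedCycle])
    | succ k ih => exact ht _ _ _ ih (hc _ _ (by simp [directedCycle]))
  obtain ⟨k, rfl⟩ : ∃ k, n = k + 1 := ⟨n - 1, by omega⟩
  have := key k
  rw [ZMod.natCast_self] at this
  exact hl _ this

theorem IsAcyclic.of_injective (h : E.IsAcyclic) (g : V → W) (hg : Function.Injective g)
    (hadj : ∀ x y, D.Adj x y → E.Adj (g x) (g y)) : D.IsAcyclic := by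
  rintro n hn ⟨c, hc, hcadj⟩
  exact h n hn ⟨g ∘ c, hg.comp hc, fun i j hij => hadj _ _ (hcadj i j hij)⟩

end Cycles

section Splitting

variable {V : Type u} {D : Digraph V}

/-- A two-colouring (by booleans) without monochromatic directed triangle. -/
def SplitsTriangles (D : Digraph V) (χ : V → Bool) : Prop :=
  ∀ x y z, D.Adj x y → D.Adj y z → D.Adj z x → χ x = χ y → χ y ≠ χ z

theorem IsDicolouring.splitsTriangles (hl : D.Loopless) {φ : V → Fin 2} (h : D.IsDicolouring φ) :
    D.SplitsTriangles fun x => decide (φ x = 0) := by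
  have key : ∀ a b : Fin 2, decide (a = 0) = decide (b = 0) → a = b := by decide
  intro x y z hxy hyz hzx h1 h2
  have h1 := key _ _ h1
  have h2 := key _ _ h2
  exact (h (φ y)).not_adj_of_triangle (x := ⟨x, h1⟩) (y := ⟨y, rfl⟩) (z := ⟨z, h2.symm⟩)
    (fun a => hl a.1) hxy hyz hzx

theorem IsTournament.adj_iff (hT : D.IsTournament) {x y : V} (hxy : x ≠ y) :
    D.Adj x y ↔ ¬ D.Adj y x :=
  ⟨fun h h' => hT.2 ⟨x, y, hxy, h, h'⟩, fun h => (hT.1.2 x y hxy).resolve_right h⟩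

/-- In a tournament, a set of vertices without directed triangle is transitive, hence acyclic. -/
theorem SplitsTriangles.isDicolouring (hT : D.IsTournament) {χ : V → Bool}
    (h : D.SplitsTriangles χ) : D.IsDicolouring fun x => if χ x then (0 : Fin 2) else 1 := by
  intro i
  have key : ∀ x y : V, (if χ x then (0 : Fin 2) else 1) = (if χ y then 0 else 1) →
      χ x = χ y := by
    intro x y
    cases χ x <;> cases χ y <;> simp
  refine isAcyclic_of_trans (fun a => hT.1.1 a.1) ?_
  rintro ⟨x, hx⟩ ⟨y, hy⟩ ⟨z, hz⟩ hxy hyz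
  change D.Adj x y at hxy
  change D.Adj y z at hyz
  change D.Adj x z
  have hne : x ≠ z := by
    rintro rfl
    exact hT.2 ⟨x, y, fun e => hT.1.1 y (e ▸ hxy), hxy, hyz⟩
  rw [hT.adj_iff hne]
  intro hzx
  exact h x y z hxy hyz hzx (key _ _ (hx.trans hy.symm)) (key _ _ (hy.trans hz.symm))

/-- The digraph obtained from `D` by replacing the arc from `u` to `v` with the opposite arc. -/
def reverseArc (D : Digraph V) (u v : V) : Digraph V where
  Adj x y := (D.Adj x y ∧ ¬ (x = u ∧ y = v)) ∨ (x = v ∧ y = u)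

theorem IsTournament.reverseArc (hT : D.IsTournament) {u v : V} (huv : D.Adj u v) :
    (D.reverseArc u v).IsTournament := by
  have hne : u ≠ v := by rintro rfl; exact hT.1.1 _ huv
  refine ⟨⟨?_, ?_⟩, ?_⟩
  · rintro x (⟨h, -⟩ | ⟨h, h'⟩)
    · exact hT.1.1 x h
    · exact hne (h' ▸ h)
  · intro x y hxy
    by_cases h1 : x = u ∧ y = v
    · exact Or.inr (Or.inr ⟨h1.2, h1.1⟩)
    by_cases h2 : y = u ∧ x = v
    · exact Or.inl (Or.inr ⟨h2.2, h2.1⟩)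
    exact (hT.1.2 x y hxy).imp (fun h => Or.inl ⟨h, h1⟩) fun h => Or.inl ⟨h, h2⟩
  · rintro ⟨x, y, hxy, h1 | h1, h2 | h2⟩
    · exact hT.2 ⟨x, y, hxy, h1.1, h2.1⟩
    · exact h1.2 ⟨h2.2, h2.1⟩
    · exact h2.2 ⟨h1.2, h1.1⟩
    · exact hxy (h1.1.trans h2.1.symm)

theorem IsDicritical.not_splitsTriangles (hT : D.IsTournament) (hD : D.IsDicritical 3)
    (χ : V → Bool) : ¬ D.SplitsTriangles χ :=
  fun h => hD.2.1 ⟨_, h.isDicolouring hT⟩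

theorem IsDicritical.exists_colouring_delete_vertex (hT : D.IsTournament)
    (hD : D.IsDicritical 3) (w : V) :
    ∃ χ : V → Bool, ∀ x y z, x ≠ w → y ≠ w → z ≠ w → D.Adj x y → D.Adj y z → D.Adj z x →
      χ x = χ y → χ y ≠ χ z := by
  classical
  let H : D.Subdigraph :=
    { verts := {w}ᶜ
      Adj := fun x y => D.Adj x y ∧ x ≠ w ∧ y ≠ w
      adj_sub := fun h => h.1
      fst_mem := fun h => h.2.1
      snd_mem := fun h => h.2.2 }
  obtain ⟨φ, hφ⟩ := hD.2.2 H (Or.inl fun h => by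
    have : w ∈ ({w}ᶜ : Set V) := by rw [show ({w}ᶜ : Set V) = Set.univ from h]; trivial
    exact this rfl)
  have hs := IsDicolouring.splitsTriangles (D := H.coe) (fun a h => hT.1.1 a.1 (H.adj_sub h)) hφ
  refine ⟨fun x => if hx : x ≠ w then decide (φ ⟨x, hx⟩ = 0) else true, ?_⟩
  intro x y z hx hy hz hxy hyz hzx
  have := hs ⟨x, hx⟩ ⟨y, hy⟩ ⟨z, hz⟩ ⟨hxy, hx, hy⟩ ⟨hyz, hy, hz⟩ ⟨hzx, hz, hx⟩
  simp only [dif_pos hx, dif_pos hy, dif_pos hz]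
  exact this

/-- The local consequence of criticality at an arc from `u` to `v`. The deletion of the arc gives
a dicolouring, in which `u`, `v` and a vertex `w` form a monochromatic triangle of `D`. A vertex
`x` of the same colour with arcs from `u` to `x` and from `x` to `v` would close the directed
cycle `u x v w`, so that even the reversed arc creates no monochromatic triangle. -/
theorem IsDicritical.exists_colouring_reverseArc (hT : D.IsTournament) (hD : D.IsDicritical 3)
    {u v : V} (huv : D.Adj u v) :
    ∃ (χ : V → Bool) (w : V), (D.reverseArc u v).SplitsTriangles χ ∧
      χ u = true ∧ χ v = true ∧ χ w = true ∧ D.Adj v w ∧ D.Adj w u := by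
  classical
  let H : D.Subdigraph :=
    { verts := Set.univ
      Adj := fun x y => D.Adj x y ∧ ¬ (x = u ∧ y = v)
      adj_sub := fun h => h.1
      fst_mem := fun _ => trivial
      snd_mem := fun _ => trivial }
  obtain ⟨φ, hφ⟩ := hD.2.2 H (Or.inr fun h => by
    have : H.Adj u v := by rw [h]; exact huv
    exact this.2 ⟨rfl, rfl⟩)
  have hl : H.coe.Loopless := fun a h => hT.1.1 a.1 h.1
  have hs := IsDicolouring.splitsTriangles hl hφ
  set c : V → Bool := fun x => decide (φ ⟨x, trivial⟩ = 0) with hc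
  have hs' : ∀ x y z, H.Adj x y → H.Adj y z → H.Adj z x → c x = c y → c y ≠ c z :=
    fun x y z hxy hyz hzx => hs ⟨x, trivial⟩ ⟨y, trivial⟩ ⟨z, trivial⟩ hxy hyz hzx
  -- the monochromatic triangle of `D` consists of the deleted arc and a third vertex
  obtain ⟨w, hvw, hwu, huv', hvw'⟩ : ∃ w, D.Adj v w ∧ D.Adj w u ∧ c u = c v ∧ c v = c w := by
    by_contra hcon
    push Not at hcon
    refine hD.not_splitsTriangles hT c fun x y z hxy hyz hzx h1 h2 => ?_
    by_cases e1 : x = u ∧ y = v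
    · obtain ⟨rfl, rfl⟩ := e1
      exact hcon z hyz hzx h1 h2
    by_cases e2 : y = u ∧ z = v
    · obtain ⟨rfl, rfl⟩ := e2
      exact hcon x hzx hxy h2 (h2.symm.trans h1.symm)
    by_cases e3 : z = u ∧ x = v
    · obtain ⟨rfl, rfl⟩ := e3
      exact hcon y hxy hyz (h2.symm.trans h1.symm) h1
    exact hs' x y z ⟨hxy, e1⟩ ⟨hyz, e2⟩ ⟨hzx, e3⟩ h1 h2
  have hne : u ≠ v := by rintro rfl; exact hT.1.1 _ huv
  have hwu' : w ≠ u := by rintro rfl; exact hT.1.1 _ hwu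
  have hwv' : w ≠ v := by rintro rfl; exact hT.1.1 _ hvw
  have hmid : ∀ x, D.Adj u x → D.Adj x v → c x ≠ c u := by
    intro x hux hxv hx
    have hcol : ∀ y, c y = c u → φ ⟨y, trivial⟩ = φ ⟨u, trivial⟩ := by
      have key : ∀ a b : Fin 2, decide (a = 0) = decide (b = 0) → a = b := by decide
      exact fun y hy => key _ _ hy
    have hxv' : x ≠ v := by rintro rfl; exact hT.1.1 _ hxv
    have hxu : x ≠ u := by rintro rfl; exact hT.1.1 _ hux
    have hxw : x ≠ w := by
      rintro rfl
      exact hT.2 ⟨u, x, hwu'.symm, hux, hwu⟩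
    exact (hφ (φ ⟨u, trivial⟩)).not_adj_of_quadrangle (fun a => hl a.1)
      (x := ⟨⟨u, trivial⟩, rfl⟩) (y := ⟨⟨x, trivial⟩, hcol x hx⟩)
      (z := ⟨⟨v, trivial⟩, hcol v huv'.symm⟩)
      (w := ⟨⟨w, trivial⟩, hcol w (huv'.trans hvw').symm⟩)
      (fun h => hne congr(($h).1.1)) (fun h => hxw congr(($h).1.1))
      ⟨hux, fun h => hxv' h.2⟩ ⟨hxv, fun h => hxu h.1⟩
      ⟨hvw, fun h => hwv' h.2⟩ ⟨hwu, fun h => hwu' h.1⟩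
  refine ⟨fun x => c x == c u, w, ?_, by simp, by simp [huv'], by simp [huv', hvw'], hvw, hwu⟩
  have htr : ∀ x y, (c x == c u) = (c y == c u) → c x = c y := by
    intro x y
    cases c x <;> cases c y <;> cases c u <;> simp
  have hrev : ∀ x, (D.reverseArc u v).Adj u x → (D.reverseArc u v).Adj x v → c x ≠ c u := by
    rintro x (h1 | h1) (h2 | h2)
    · exact hmid x h1.1 h2.1
    · exact absurd h2.2.symm hne
    · exact absurd h1.1 hne
    · exact absurd h1.1 hne
  intro x y z hxy hyz hzx h1 h2
  have h1 := htr _ _ h1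
  have h2 := htr _ _ h2
  rcases hxy with hxy' | ⟨rfl, rfl⟩
  · rcases hyz with hyz' | ⟨rfl, rfl⟩
    · rcases hzx with hzx' | ⟨rfl, rfl⟩
      · exact hs' x y z hxy' hyz' hzx' h1 h2
      · exact hrev y (Or.inl hxy') (Or.inl hyz') h1.symm
    · exact hrev x hzx (Or.inl hxy') (h1.trans h2)
  · exact hrev z hyz hzx h2.symm

/-- Criticality can be tested by reversing arcs: a subdigraph that misses an arc of `D` is
contained in the tournament in which that arc is reversed. -/
theorem IsTournament.isDicritical (hT : D.IsTournament) (hcol : ∀ χ, ¬ D.SplitsTriangles χ)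
    (hV : ∀ x : V, ∃ y, y ≠ x)
    (harc : ∀ u v, D.Adj u v → ∃ χ, (D.reverseArc u v).SplitsTriangles χ) :
    D.IsDicritical 3 := by
  refine ⟨by norm_num, ?_, ?_⟩
  · rintro ⟨φ, hφ⟩
    exact hcol _ (IsDicolouring.splitsTriangles hT.1.1 hφ)
  · intro H hH
    obtain ⟨u, v, huv, hnot⟩ : ∃ u v, D.Adj u v ∧ ¬ H.Adj u v := by
      rcases hH with hH | hH
      · obtain ⟨x, hx⟩ := (Set.ne_univ_iff_exists_notMem _).1 hH
        obtain ⟨y, hy⟩ := hV x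
        rcases hT.1.2 x y hy.symm with h | h
        · exact ⟨x, y, h, fun h' => hx (H.fst_mem h')⟩
        · exact ⟨y, x, h, fun h' => hx (H.snd_mem h')⟩
      · by_contra hcon
        push Not at hcon
        exact hH (funext fun x => funext fun y => propext ⟨H.adj_sub, hcon x y⟩)
    obtain ⟨χ, hχ⟩ := harc u v huv
    refine ⟨fun x => if χ x.1 then (0 : Fin 2) else 1, fun i => ?_⟩
    refine (hχ.isDicolouring (hT.reverseArc huv) i).of_injective
      (fun x => ⟨x.1.1, x.2⟩) ?_ ?_
    · intro x y hxy
      exact Subtype.ext (Subtype.ext congr(($hxy).1))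
    · intro x y hxy
      refine Or.inl ⟨H.adj_sub hxy, ?_⟩
      rintro ⟨h1, h2⟩
      have : H.Adj x.1.1 y.1.1 := hxy
      rw [show x.1.1 = u from h1, show y.1.1 = v from h2] at this
      exact hnot this

end Splitting

end Digraph

namespace TournamentCode

/-! ### The search on codes of tournaments

The functions of this part are evaluated by the kernel. For this reason they are written with
recursors and with the operations on natural numbers that the kernel computes natively, and they
rely on lazy evaluation. -/

/-- The bit `i` of `a`, as a boolean. -/
def bit (a i : ℕ) : Bool := Nat.beq 1 (Nat.land 1 (Nat.shiftRight a i))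

/-- Whether `p` holds for all numbers below `n`. -/
def allBelow (n : ℕ) (p : ℕ → Bool) : Bool :=
  Nat.rec true (fun k ih => bif p k then ih else false) n

/-- Whether `p` holds for some number below `n`. -/
def anyBelow (n : ℕ) (p : ℕ → Bool) : Bool :=
  Nat.rec false (fun k ih => bif p k then true else ih) n

/-- The list obtained from `acc` by applying `f 0, …, f (n - 1)` in turn. -/
def foldBelow {α : Type} (n : ℕ) (f : ℕ → List α → List α) (acc : List α) : List α :=
  Nat.rec acc f n

/-- The set `{i < n | p i}`, as a bit mask. -/
def maskOf (n : ℕ) (p : ℕ → Bool) : ℕ :=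
  Nat.rec 0 (fun k ih => bif p k then Nat.lor (Nat.pow 2 k) ih else ih) n

/-- The value `f n`. The recursor makes the kernel evaluate `n` before it unfolds `f`, so that
`n` is not evaluated again at each of its occurrences. -/
def force {α : Type} (n : ℕ) (f : ℕ → α) : α :=
  Nat.rec (f 0) (fun k _ => f (Nat.succ k)) n

/-- The tournament coded by `N` has an arc from `i` to `j` if the bit `8 * i + j` of `N` is set.
A code is used for tournaments on the vertices `0, …, m - 1` with `m ≤ 8`. -/
def arc (N i j : ℕ) : Bool := bit N (Nat.add (Nat.mul 8 i) j)

/-- The set of all `m` vertices. -/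
def full (m : ℕ) : ℕ := Nat.sub (Nat.pow 2 m) 1

/-- The set of the out-neighbours of `i`. -/
def outSet (m N i : ℕ) : ℕ := Nat.land (full m) (Nat.shiftRight N (Nat.mul 8 i))

/-- The set of the vertices `x` such that `u x v` is a directed path. -/
def path (m N u v : ℕ) : ℕ :=
  Nat.land (outSet m N u) (Nat.xor (full m) (Nat.lor (Nat.pow 2 v) (outSet m N v)))

/-- The set `{i, j, k}`. -/
def triple (i j k : ℕ) : ℕ := Nat.lor (Nat.pow 2 i) (Nat.lor (Nat.pow 2 j) (Nat.pow 2 k))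

/-- The vertex sets of the directed triangles, listed by their vertices `i > j > k`. -/
def triangles (m N : ℕ) : List ℕ :=
  foldBelow m (fun i acc => foldBelow i (fun j acc =>
    force (bif arc N i j then path m N j i else path m N i j) fun W =>
      foldBelow j (fun k acc =>
        bif bit W k then force (triple i j k) fun t => t :: acc else acc) acc) acc) []

/-- The list `R` without its leading triples that meet both `A` and `B`. -/
def dropSplit (A B : ℕ) (R : List ℕ) : List ℕ :=
  List.rec [] (fun t R' ih =>
    bif Nat.beq 0 (Nat.mul (Nat.land t A) (Nat.land t B)) then t :: R' else ih) R

/-- One branching of `splits`, where the head of `R` does not meet both `A` and `B`: it gives a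
vertex of the head that is in neither of `A` and `B` (if there is one) to `A` or to `B`, and goes on
with `rest`. -/
def splitHead (rest : List ℕ → ℕ → ℕ → Bool) (A B : ℕ) (R : List ℕ) : Bool :=
  List.rec true (fun t R' _ =>
    Nat.rec false (fun k _ => force (Nat.pow 2 (Nat.log2 (Nat.succ k))) fun l =>
      bif force (Nat.lor l A) fun A' => rest (t :: R') A' B then true
      else force (Nat.lor l B) fun B' => rest (t :: R') A B')
    (Nat.xor t (Nat.land t (Nat.lor A B)))) R

/-- Whether a search through at most `n` branchings along each branch does not refute that there
are disjoint sets containing `A` and `B` that both meet every member of `R`. The value is `true` if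
the bound `n` is too small, so only the value `false` is informative. -/
def splits (n : ℕ) : List ℕ → ℕ → ℕ → Bool :=
  Nat.rec (fun _ _ _ => true)
    (fun _ rest R A B => splitHead rest A B (dropSplit A B R)) n

/-- The members of `T` that do not contain `b`. -/
def without (b : ℕ) (T : List ℕ) : List ℕ :=
  List.rec [] (fun t _ ih => bif Nat.beq (Nat.land t b) b then ih else t :: ih) T

/-- Whether the search finds no obstruction to a two-colouring that splits the triangles of the
tournament with the arc from `u` to `v` reversed, where `u`, `v` and the set `E` get the first
colour. The triangles through the reversed arc are `v u x` with `x` in `path m N u v`, so these `x`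
get the second colour. Here `T` is the list of all triangles. -/
def arcSplits (m N : ℕ) (T : List ℕ) (u v E : ℕ) : Bool :=
  force (Nat.lor (Nat.pow 2 u) (Nat.pow 2 v)) fun b =>
  force (Nat.lor E b) fun A =>
  force (path m N u v) fun B =>
    splits 100 (without b T) A B

/-- Whether `p` holds for all arcs. -/
def allArcs (m N : ℕ) (p : ℕ → ℕ → Bool) : Bool :=
  allBelow m fun i => allBelow i fun j => bif arc N i j then p i j else p j i

/-- Whether no arc is an obstruction to being contained in a 3-dicritical tournament. -/
def viable (m N : ℕ) : Bool :=
  allArcs m N fun u v => arcSplits m N (triangles m N) u v 0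

/-- The arcs `(u, v)` that have no colouring as in `arcSplits` in which some `x` that completes
`u v` to a directed triangle has the same colour as `u` and `v`. -/
def openArcs (m N : ℕ) : List (ℕ × ℕ) :=
  foldBelow m (fun i acc => foldBelow i (fun j acc =>
    force (bif arc N i j then i else j) fun u => force (bif arc N i j then j else i) fun v =>
      force (path m N v u) fun W =>
        bif anyBelow m fun x => bif bit W x then
          arcSplits m N (triangles m N) u v (Nat.pow 2 x) else false
        then acc else (u, v) :: acc) acc) []

/-- Whether the bipartition of the vertices given by `A` splits all directed triangles of the
relation `r`. -/
def isColouring (m : ℕ) (r : ℕ → ℕ → Bool) (A : ℕ) : Bool :=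
  allBelow m fun i => allBelow m fun j => bif r i j then
    bif xor (bit A i) (bit A j) then true else
      allBelow m fun k => bif r j k then bif r k i then xor (bit A i) (bit A k) else true else true
  else true

/-- Whether some bipartition of the vertices splits all directed triangles of the relation `r`. -/
def colourable (m : ℕ) (r : ℕ → ℕ → Bool) : Bool :=
  anyBelow (Nat.pow 2 m) fun A => isColouring m r A

/-- The code of the tournament obtained by adding the vertex `m` with the set `q` of
out-neighbours. -/
def extend (m N q : ℕ) : ℕ := maskOf (Nat.mul 8 (Nat.succ m)) fun x =>
  bif Nat.beq (Nat.div x 8) m then bit q (Nat.mod x 8) else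
  bif Nat.beq (Nat.mod x 8) m then not (bit q (Nat.div x 8)) else bit N x

/-- The viable extensions by a vertex that completes the arc from `u` to `v` to a directed triangle
and has the colour of `u` and `v` in a colouring as in `arcSplits`. -/
def extensionsAlong (m N u v : ℕ) : List ℕ :=
  foldBelow (Nat.pow 2 m) (fun q acc =>
    bif bit q u then bif bit q v then acc else
      force (extend m N q) fun N' =>
        bif arcSplits (Nat.succ m) N' (triangles (Nat.succ m) N') u v (Nat.pow 2 m) then
          bif viable (Nat.succ m) N' then N' :: acc else acc
        else acc
    else acc) []

/-- The viable extensions by one vertex. -/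
def allExtensions (m N : ℕ) : List ℕ :=
  foldBelow (Nat.pow 2 m) (fun q acc => force (extend m N q) fun N' =>
    bif viable (Nat.succ m) N' then N' :: acc else acc) []

/-- Viable extensions by one vertex, one of which occurs in any 3-dicritical tournament that
contains the coded tournament properly: if there is an open arc, those along one such arc. -/
def extensions (m N : ℕ) : List ℕ :=
  match openArcs m N with
  | a :: _ => extensionsAlong m N a.1 a.2
  | [] => allExtensions m N

/-- The out-degree of `i`. -/
def score (m N i : ℕ) : ℕ :=
  Nat.rec 0 (fun j ih => bif arc N i j then Nat.succ ih else ih) m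

/-- Whether `g` preserves the arcs, in both directions, between `l` and the vertices up to `l`. -/
def agree (P N l : ℕ) (g : ℕ → ℕ) : Bool :=
  allBelow (Nat.succ l) fun j =>
    bif xor (arc P l j) (arc N (g l) (g j)) then false
    else not (xor (arc P j l) (arc N (g j) (g l)))

/-- Whether the embedding `g` of the first `l` vertices of `P` into `N` extends to the next `k`
vertices, with preservation of scores (which holds for isomorphisms and shortens the search). -/
def embedsFrom (m P N : ℕ) (k : ℕ) : ℕ → (ℕ → ℕ) → Bool :=
  Nat.rec (fun _ _ => true) (fun _ ih l g =>
    anyBelow m fun x =>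
      bif (bif Nat.beq (score m P l) (score m N x) then anyBelow l fun j => Nat.beq (g j) x
        else true) then false else
        (fun g' : ℕ → ℕ => bif agree P N l g' then ih (Nat.succ l) g' else false)
          fun j => bif Nat.beq j l then x else g j) k

/-- Whether the tournaments on `m` vertices coded by `P` and `N` are isomorphic. -/
def embeds (m P N : ℕ) : Bool := embedsFrom m P N m 0 fun _ => 0

/-- A number that determines the multiset of scores, as scores are below 8. -/
def scoreSum (m N : ℕ) : ℕ :=
  Nat.rec 0 (fun i ih => Nat.add ih (Nat.pow 8 (score m N i))) m

/-- Adds `N` to the list `l` unless `l` has a member isomorphic to it. -/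
def insertCode (m N : ℕ) (l : List ℕ) : List ℕ :=
  force (scoreSum m N) fun s =>
    bif l.any fun P => bif Nat.beq (scoreSum m P) s then embeds m P N else false then l else N :: l

/-- The code of `R(C₃, C₃)`: the vertex `0` is the root, and the triangles are `1, 2, 3` and
`4, 5, 6`. The numbers `a` and `b` tell which of these three parts the end vertices of the arc lie
in. -/
def rotativeCode : ℕ := maskOf 56 fun x =>
  let a := (x / 8 + 2) / 3
  let b := (x % 8 + 2) / 3
  bif a == b then (x % 8) % 3 == (x / 8 + 1) % 3 else b == (a + 1) % 3

/-- The code of the Paley tournament: the set `{1, 2, 4}` of the squares has the mask 22. -/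
def paleyCode : ℕ := maskOf 56 fun x => bit 22 ((x % 8 + 7 - x / 8) % 7)

/-- Whether `N` is isomorphic to one of the two tournaments of the classification. -/
def isTarget (m N : ℕ) : Bool :=
  bif Nat.beq m 7 then bif embeds 7 rotativeCode N then true else embeds 7 paleyCode N else false

/-- Adds the members of `l` that are not targets to the list `acc`, up to isomorphism. -/
def insertAll (m : ℕ) (l acc : List ℕ) : List ℕ :=
  l.foldr (fun N acc => bif isTarget m N then acc else insertCode m N acc) acc

/-- The extensions of the members of `l` by one vertex, up to isomorphism and without the
targets. -/
def step (m : ℕ) (l : List ℕ) : List ℕ :=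
  l.foldr (fun N acc => insertAll (Nat.succ m) (extensions m N) acc) []

/-- Whether, starting from the tournaments `l` on `m` vertices, only 2-dicolourable tournaments
arise in fewer than `n` steps, and nothing is left after `n` steps. -/
def exhausted (n : ℕ) : ℕ → List ℕ → Bool :=
  Nat.rec (fun _ l => l.isEmpty) (fun _ ih m l =>
    bif l.all fun N => colourable m (arc N) then ih (Nat.succ m) (step m l) else false) n

/-- The arcs of the tournament with the arc from `u` to `v` reversed. -/
def reversed (N u v i j : ℕ) : Bool :=
  bif (bif Nat.beq i v then Nat.beq j u else false) then true else
  bif (bif Nat.beq i u then Nat.beq j v else false) then false else arc N i j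

/-- Whether no bipartition splits all directed triangles, but the reversal of any arc admits one. -/
def isCritical (m N : ℕ) : Bool :=
  bif colourable m (arc N) then false else allArcs m N fun u v => colourable m (reversed N u v)

/-! ### Correctness of the elementary operations -/

theorem bit_eq (a i : ℕ) : bit a i = a.testBit i := by
  have h : bit a i = decide ((1 : ℕ) = 1 &&& (a >>> i)) := by
    rw [Bool.eq_iff_iff, decide_eq_true_iff]
    exact Iff.of_eq Nat.beq_eq
  rw [h, Nat.testBit, Nat.one_and_eq_mod_two]
  rcases Nat.mod_two_eq_zero_or_one (a >>> i) with h | h <;> simp [h]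

theorem allBelow_iff {n : ℕ} {p : ℕ → Bool} : allBelow n p = true ↔ ∀ i < n, p i = true := by
  induction n with
  | zero => simp [allBelow]
  | succ n ih =>
    change (bif p n then allBelow n p else false) = true ↔ _
    simp only [Bool.cond_false_right, Bool.and_eq_true, ih, Nat.lt_succ_iff_lt_or_eq]
    constructor
    · rintro ⟨h1, h2⟩ i (hi | rfl)
      exacts [h2 i hi, h1]
    · exact fun h => ⟨h n (Or.inr rfl), fun i hi => h i (Or.inl hi)⟩

theorem anyBelow_iff {n : ℕ} {p : ℕ → Bool} : anyBelow n p = true ↔ ∃ i < n, p i = true := by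
  induction n with
  | zero => simp [anyBelow]
  | succ n ih =>
    change (bif p n then true else anyBelow n p) = true ↔ _
    simp only [Bool.cond_true_left, Bool.or_eq_true, ih, Nat.lt_succ_iff_lt_or_eq]
    constructor
    · rintro (h | ⟨i, hi, h⟩)
      exacts [⟨n, Or.inr rfl, h⟩, ⟨i, Or.inl hi, h⟩]
    · rintro ⟨i, hi | rfl, h⟩
      exacts [Or.inr ⟨i, hi, h⟩, Or.inl h]

theorem testBit_maskOf (n : ℕ) (p : ℕ → Bool) (i : ℕ) :
    (maskOf n p).testBit i = (decide (i < n) && p i) := by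
  induction n with
  | zero => simp [maskOf]
  | succ n ih =>
    change (bif p n then 2 ^ n ||| maskOf n p else maskOf n p).testBit i = _
    rcases eq_or_ne i n with rfl | hne
    · cases h : p i <;> simp [ih]
    · have : i < n + 1 ↔ i < n := by omega
      cases h : p n <;> simp [ih, hne.symm, this]

theorem maskOf_lt (n : ℕ) (p : ℕ → Bool) : maskOf n p < 2 ^ n := by
  refine Nat.lt_pow_two_of_testBit _ fun i hi => ?_
  simp [testBit_maskOf, Nat.not_lt.2 hi]

theorem force_eq {α : Type} (n : ℕ) (f : ℕ → α) : force n f = f n := by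
  cases n <;> rfl

theorem testBit_outSet (m N i x : ℕ) :
    (outSet m N i).testBit x = (decide (x < m) && arc N i x) := by
  change ((2 ^ m - 1) &&& (N >>> (8 * i))).testBit x = (_ && bit N (8 * i + x))
  rw [Nat.testBit_and, Nat.testBit_two_pow_sub_one, Nat.testBit_shiftRight, bit_eq]

theorem testBit_path (m N u v x : ℕ) : (path m N u v).testBit x = true ↔
    x < m ∧ arc N u x = true ∧ x ≠ v ∧ arc N v x = false := by
  change (outSet m N u &&& ((2 ^ m - 1) ^^^ (2 ^ v ||| outSet m N v))).testBit x = true ↔ _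
  rw [Nat.testBit_and, Nat.testBit_xor, Nat.testBit_or, Nat.testBit_two_pow_sub_one,
    Nat.testBit_two_pow, testBit_outSet, testBit_outSet]
  by_cases hx : x < m <;> by_cases hv : x = v <;> cases arc N u x <;> cases arc N v x <;>
    simp [hx, hv, Ne.symm]

theorem testBit_triple (i j k l : ℕ) :
    (triple i j k).testBit l = true ↔ l = i ∨ l = j ∨ l = k := by
  change (2 ^ i ||| (2 ^ j ||| 2 ^ k)).testBit l = true ↔ _
  simp [Nat.testBit_or, Nat.testBit_two_pow, @eq_comm _ l]

section Fold

variable {α : Type} {n : ℕ} {f : ℕ → List α → List α} {acc : List α} {a : α}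

theorem mem_foldBelow {Q : ℕ → Prop} (h : ∀ k < n, ∀ l, a ∈ f k l → a ∈ l ∨ Q k)
    (ha : a ∈ foldBelow n f acc) : a ∈ acc ∨ ∃ k < n, Q k := by
  induction n with
  | zero => exact Or.inl ha
  | succ n ih =>
    rcases h n n.lt_succ_self _ ha with ha | ha
    · exact (ih (fun k hk => h k (hk.trans n.lt_succ_self)) ha).imp_right
        fun ⟨k, hk, hQ⟩ => ⟨k, hk.trans n.lt_succ_self, hQ⟩
    · exact Or.inr ⟨n, n.lt_succ_self, ha⟩

theorem mem_foldBelow_of_step (hmono : ∀ k l, a ∈ l → a ∈ f k l) {k : ℕ} (hk : k < n)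
    (hstep : ∀ l, a ∈ f k l) : a ∈ foldBelow n f acc := by
  induction n with
  | zero => exact absurd hk k.not_lt_zero
  | succ n ih =>
    rcases Nat.lt_succ_iff_lt_or_eq.1 hk with hk | rfl
    · exact hmono _ _ (ih hk)
    · exact hstep _

end Fold

/-! ### Copies of codes and the refutation of colourings -/

open Digraph

universe u v

section Copies

variable {V : Type u} {D : Digraph V} {m N : ℕ} {f : ℕ → V}

/-- The map `f` embeds the tournament on `m` vertices coded by `N` into `D`, as an induced
subdigraph. Only the values of `f` below `m` matter. -/
structure IsCopy (D : Digraph V) (m N : ℕ) (f : ℕ → V) : Prop where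
  inj : ∀ i < m, ∀ j < m, f i = f j → i = j
  arc_iff : ∀ i < m, ∀ j < m, (arc N i j = true ↔ D.Adj (f i) (f j))

theorem IsCopy.adj_of_not_arc (hf : IsCopy D m N f) (hT : D.IsTournament) {i j : ℕ} (hi : i < m)
    (hj : j < m) (hij : i ≠ j) (h : arc N i j = false) : D.Adj (f j) (f i) := by
  refine (hT.1.2 _ _ fun e => hij (hf.inj i hi j hj e)).resolve_left fun h' => ?_
  rw [(hf.arc_iff i hi j hj).2 h'] at h
  exact Bool.noConfusion h

theorem IsCopy.testBit_path_iff (hf : IsCopy D m N f) (hT : D.IsTournament) {u v : ℕ} (hu : u < m)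
    (hv : v < m) (x : ℕ) : (path m N u v).testBit x = true ↔
      x < m ∧ D.Adj (f u) (f x) ∧ D.Adj (f x) (f v) := by
  rw [testBit_path]
  refine and_congr_right fun hx => ?_
  rw [hf.arc_iff u hu x hx]
  refine and_congr_right fun _ => ⟨fun ⟨h1, h2⟩ => hf.adj_of_not_arc hT hv hx h1.symm h2, ?_⟩
  intro h
  have hxv : x ≠ v := by rintro rfl; exact hT.1.1 _ h
  refine ⟨hxv, ?_⟩
  by_contra hc
  rw [Bool.not_eq_false, hf.arc_iff v hv x hx] at hc
  exact hT.2 ⟨_, _, fun e => hxv (hf.inj _ hx _ hv e), h, hc⟩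

theorem IsCopy.of_mem_triangles (hf : IsCopy D m N f) (hT : D.IsTournament) {t : ℕ}
    (ht : t ∈ triangles m N) : ∃ i j k, i < m ∧ j < m ∧ k < m ∧
      D.Adj (f i) (f j) ∧ D.Adj (f j) (f k) ∧
      D.Adj (f k) (f i) ∧ ∀ l, t.testBit l = true ↔ l = i ∨ l = j ∨ l = k := by
  refine (mem_foldBelow (Q := fun _ => ∃ i j k, i < m ∧ j < m ∧ k < m ∧
      D.Adj (f i) (f j) ∧ D.Adj (f j) (f k) ∧
      D.Adj (f k) (f i) ∧ ∀ l, t.testBit l = true ↔ l = i ∨ l = j ∨ l = k)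
      (fun i hi acc h => ?_) ht).elim (fun h => absurd h (List.not_mem_nil)) fun ⟨_, _, h⟩ => h
  refine (mem_foldBelow (Q := fun _ => ∃ i j k, i < m ∧ j < m ∧ k < m ∧
      D.Adj (f i) (f j) ∧ D.Adj (f j) (f k) ∧
      D.Adj (f k) (f i) ∧ ∀ l, t.testBit l = true ↔ l = i ∨ l = j ∨ l = k)
      (fun j hj acc h => ?_) h).imp_right fun ⟨_, _, h⟩ => h
  have hjm := hj.trans hi
  rw [force_eq] at h
  refine (mem_foldBelow (Q := fun k => t = triple i j k ∧
      (bif arc N i j then path m N j i else path m N i j).testBit k = true)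
      (fun k hk acc h => ?_) h).imp_right ?_
  · rw [force_eq, bit_eq] at h
    cases hb : (bif arc N i j then path m N j i else path m N i j).testBit k
    · rw [hb] at h
      exact Or.inl h
    · rw [hb, cond_true, List.mem_cons] at h
      exact h.symm.imp_right fun h => ⟨h, rfl⟩
  · rintro ⟨k, hk, rfl, hb⟩
    cases ha : arc N i j
    · rw [ha, cond_false, hf.testBit_path_iff hT hi hjm] at hb
      refine ⟨j, i, k, hjm, hi, hk.trans hjm, hf.adj_of_not_arc hT hi hjm hj.ne' ha, hb.2.1,
        hb.2.2, fun l => ?_⟩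
      rw [testBit_triple]
      tauto
    · rw [ha, cond_true, hf.testBit_path_iff hT hjm hi] at hb
      exact ⟨i, j, k, hi, hjm, hk.trans hjm, (hf.arc_iff i hi j hjm).1 ha, hb.2.1, hb.2.2,
        testBit_triple i j k⟩

theorem dropSplit_subset (A B : ℕ) (R : List ℕ) : dropSplit A B R ⊆ R := by
  induction R with
  | nil => exact List.Subset.refl _
  | cons t R ih =>
    change (bif _ then t :: R else dropSplit A B R) ⊆ _
    cases Nat.beq 0 (Nat.mul (Nat.land t A) (Nat.land t B))
    · exact List.Subset.trans ih (List.subset_cons_self t R)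
    · exact List.Subset.refl _

theorem land_eq_zero_of_dropSplit_eq_cons (A B : ℕ) (R : List ℕ) {t : ℕ} {R' : List ℕ}
    (h : dropSplit A B R = t :: R') : t &&& A = 0 ∨ t &&& B = 0 := by
  induction R with
  | nil => simp [dropSplit] at h
  | cons s R ih =>
    change (bif _ then s :: R else dropSplit A B R) = _ at h
    cases hb : Nat.beq 0 (Nat.mul (Nat.land s A) (Nat.land s B))
    · rw [hb] at h
      exact ih h
    · rw [hb, cond_true, List.cons.injEq] at h
      rw [← h.1]
      exact Nat.mul_eq_zero.1 (Nat.eq_of_beq_eq_true hb).symm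

/-- The search does not refute a colouring `χ` that exists. -/
theorem splits_eq_true (χ : ℕ → Bool) (n : ℕ) (R : List ℕ) (A B : ℕ)
    (hR : ∀ t ∈ R, (∃ i, t.testBit i = true ∧ χ i = true) ∧ ∃ i, t.testBit i = true ∧ χ i = false)
    (hA : ∀ i, A.testBit i = true → χ i = true) (hB : ∀ i, B.testBit i = true → χ i = false) :
    splits n R A B = true := by
  induction n generalizing R A B with
  | zero => rfl
  | succ n ih =>
    change splitHead (splits n) A B (dropSplit A B R) = true
    cases hd : dropSplit A B R with
    | nil => rfl
    | cons t R' =>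
      have hsub : t :: R' ⊆ R := hd ▸ dropSplit_subset A B R
      have hR' : ∀ s ∈ t :: R', _ := fun s hs => hR s (hsub hs)
      -- an unsplit triangle has an uncoloured vertex
      have hfree : Nat.xor t (Nat.land t (Nat.lor A B)) ≠ 0 := by
        change t ^^^ (t &&& (A ||| B)) ≠ 0
        intro h0
        obtain ⟨⟨i, hi, hχi⟩, j, hj, hχj⟩ := hR' t (List.mem_cons_self)
        have hbit : ∀ l, t.testBit l = true → A.testBit l = true ∨ B.testBit l = true := by
          intro l hl
          have := congrArg (fun a => a.testBit l) h0
          rw [← Bool.or_eq_true, ← Nat.testBit_or]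
          simpa [Nat.testBit_xor, Nat.testBit_and, hl, -Nat.testBit_or] using this
        rcases land_eq_zero_of_dropSplit_eq_cons A B R hd with h | h
        · have hz := congrArg (fun a => a.testBit i) h
          rcases hbit i hi with h' | h'
          · simp [Nat.testBit_and, hi, h'] at hz
          · rw [hB i h'] at hχi
            exact Bool.noConfusion hχi
        · have hz := congrArg (fun a => a.testBit j) h
          rcases hbit j hj with h' | h'
          · rw [hA j h'] at hχj
            exact Bool.noConfusion hχj
          · simp [Nat.testBit_and, hj, h'] at hz
      obtain ⟨k, hk⟩ := Nat.exists_eq_succ_of_ne_zero hfree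
      rw [splitHead]
      simp only [hk, force_eq]
      change (bif splits n (t :: R') (2 ^ Nat.log2 (k + 1) ||| A) B then true else
        splits n (t :: R') A (2 ^ Nat.log2 (k + 1) ||| B)) = true
      rw [Bool.cond_true_left, Bool.or_eq_true]
      have hor : ∀ (C i : ℕ), (2 ^ Nat.log2 (k + 1) ||| C).testBit i = true →
          i = Nat.log2 (k + 1) ∨ C.testBit i = true := by
        intro C i h
        rw [Nat.testBit_or, Nat.testBit_two_pow, Bool.or_eq_true, decide_eq_true_iff] at h
        exact h.imp_left Eq.symm
      cases hχ : χ (Nat.log2 (k + 1))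
      · refine Or.inr (ih _ _ _ hR' hA fun i hi => ?_)
        rcases hor _ _ hi with rfl | h
        exacts [hχ, hB i h]
      · refine Or.inl (ih _ _ _ hR' (fun i hi => ?_) hB)
        rcases hor _ _ hi with rfl | h
        exacts [hχ, hA i h]

theorem mem_without {b t : ℕ} {T : List ℕ} (h : t ∈ without b T) : t ∈ T ∧ t &&& b ≠ b := by
  induction T with
  | nil => exact absurd h List.not_mem_nil
  | cons s T ih =>
    change t ∈ (bif Nat.beq (s &&& b) b then without b T else s :: without b T) at h
    cases hb : Nat.beq (s &&& b) b
    · rw [hb, cond_false, List.mem_cons] at h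
      rcases h with rfl | h
      · exact ⟨List.mem_cons_self, Nat.ne_of_beq_eq_false hb⟩
      · exact ⟨List.mem_cons_of_mem _ (ih h).1, (ih h).2⟩
    · rw [hb] at h
      exact ⟨List.mem_cons_of_mem _ (ih h).1, (ih h).2⟩

/-- A colouring of `D` with a reversed arc restricts to any copy that contains the arc. -/
theorem IsCopy.arcSplits (hf : IsCopy D m N f) (hT : D.IsTournament) {u v E : ℕ} (hu : u < m)
    (hv : v < m) (huv : D.Adj (f u) (f v)) {χ : V → Bool}
    (hχ : (D.reverseArc (f u) (f v)).SplitsTriangles χ) (hχu : χ (f u) = true)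
    (hχv : χ (f v) = true) (hE : ∀ i, E.testBit i = true → χ (f i) = true) :
    arcSplits m N (triangles m N) u v E = true := by
  have hb : ∀ l, (2 ^ u ||| 2 ^ v).testBit l = true ↔ l = u ∨ l = v := by
    intro l
    simp [Nat.testBit_or, Nat.testBit_two_pow, @eq_comm _ l]
  have hne : f u ≠ f v := by
    intro e
    rw [e] at huv
    exact hT.1.1 _ huv
  rw [TournamentCode.arcSplits]
  simp only [force_eq]
  refine splits_eq_true (fun i => χ (f i)) _ _ _ _ ?_ ?_ ?_
  · intro t ht
    obtain ⟨ht, htb⟩ := mem_without ht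
    obtain ⟨i, j, k, hi, hj, hk, hij, hjk, hki, hbits⟩ := hf.of_mem_triangles hT ht
    have hnot : ∀ x < m, ∀ y < m, t.testBit x = true → t.testBit y = true →
        ¬ (f x = f u ∧ f y = f v) := by
      rintro x hx y hy hxt hyt ⟨h1, h2⟩
      rw [hf.inj x hx u hu h1] at hxt
      rw [hf.inj y hy v hv h2] at hyt
      refine htb (Nat.eq_of_testBit_eq fun l => ?_)
      rw [Nat.testBit_and]
      cases h : (2 ^ u ||| 2 ^ v).testBit l
      · simp
      · rcases (hb l).1 h with rfl | rfl <;> simp [hxt, hyt]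
    have hi' : t.testBit i = true := by simp [hbits]
    have hj' : t.testBit j = true := by simp [hbits]
    have hk' : t.testBit k = true := by simp [hbits]
    have hmono := hχ (f i) (f j) (f k) (Or.inl ⟨hij, hnot i hi j hj hi' hj'⟩)
      (Or.inl ⟨hjk, hnot j hj k hk hj' hk'⟩) (Or.inl ⟨hki, hnot k hk i hi hk' hi'⟩)
    cases h1 : χ (f i) <;> cases h2 : χ (f j) <;> cases h3 : χ (f k) <;>
      first
        | exact absurd (h2.trans h3.symm) (hmono (h1.trans h2.symm))
        | exact ⟨⟨i, hi', h1⟩, j, hj', h2⟩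
        | exact ⟨⟨i, hi', h1⟩, k, hk', h3⟩
        | exact ⟨⟨j, hj', h2⟩, i, hi', h1⟩
        | exact ⟨⟨j, hj', h2⟩, k, hk', h3⟩
        | exact ⟨⟨k, hk', h3⟩, i, hi', h1⟩
  · intro i hi
    change (E ||| (2 ^ u ||| 2 ^ v)).testBit i = true at hi
    rw [Nat.testBit_or, Bool.or_eq_true, hb] at hi
    rcases hi with h | rfl | rfl
    exacts [hE i h, hχu, hχv]
  · intro i hi
    rw [hf.testBit_path_iff hT hu hv] at hi
    obtain ⟨-, h1, h2⟩ := hi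
    by_contra hc
    rw [Bool.not_eq_false] at hc
    have hiv : f i ≠ f v := by
      intro e; rw [e] at h2; exact hT.1.1 _ h2
    have hiu : f i ≠ f u := by
      intro e; rw [e] at h1; exact hT.1.1 _ h1
    exact hχ (f v) (f u) (f i) (Or.inr ⟨rfl, rfl⟩) (Or.inl ⟨h1, fun h => hiv h.2⟩)
      (Or.inl ⟨h2, fun h => hiu h.1⟩) (hχv.trans hχu.symm) (hχu.trans hc.symm)

end Copies

/-! ### Extensions of copies -/

section Extensions

variable {V : Type u} {D : Digraph V} {m N : ℕ} {f : ℕ → V}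

theorem isColouring_iff {r : ℕ → ℕ → Bool} {A : ℕ} : isColouring m r A = true ↔
    ∀ i < m, ∀ j < m, ∀ k < m, r i j = true → r j k = true → r k i = true →
      A.testBit i = A.testBit j → A.testBit j ≠ A.testBit k := by
  simp only [isColouring, allBelow_iff, bit_eq]
  refine forall₂_congr fun i _ => forall₂_congr fun j _ => ?_
  cases r i j
  · simp
  cases hi : A.testBit i <;> cases hj : A.testBit j <;>
    simp only [cond_true, cond_false, Bool.xor_true, Bool.xor_false, Bool.not_true, Bool.not_false,
      allBelow_iff, reduceCtorEq, false_imp_iff, forall_true_left, implies_true]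
  all_goals
    refine forall₂_congr fun k _ => ?_
    cases r j k <;> cases r k i <;> cases A.testBit k <;> simp

theorem colourable_iff {r : ℕ → ℕ → Bool} : colourable m r = true ↔
    ∃ χ : ℕ → Bool, ∀ i < m, ∀ j < m, ∀ k < m, r i j = true → r j k = true → r k i = true →
      χ i = χ j → χ j ≠ χ k := by
  rw [colourable, anyBelow_iff]
  constructor
  · rintro ⟨A, -, h⟩
    exact ⟨A.testBit, isColouring_iff.1 h⟩
  · rintro ⟨χ, h⟩
    refine ⟨maskOf m χ, maskOf_lt m χ, isColouring_iff.2 fun i hi j hj k hk => ?_⟩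
    simpa [testBit_maskOf, hi, hj, hk] using h i hi j hj k hk

theorem allArcs_iff {p : ℕ → ℕ → Bool} : allArcs m N p = true ↔
    ∀ i < m, ∀ j < i, (arc N i j = true → p i j = true) ∧ (arc N i j = false → p j i = true) := by
  simp only [allArcs, allBelow_iff]
  refine forall₂_congr fun i _ => forall₂_congr fun j _ => ?_
  cases arc N i j <;> simp

theorem IsCopy.viable (hf : IsCopy D m N f) (hT : D.IsTournament) (hD : D.IsDicritical 3) :
    viable m N = true := by
  have key : ∀ u < m, ∀ v < m, D.Adj (f u) (f v) →
      TournamentCode.arcSplits m N (triangles m N) u v 0 = true := by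
    intro u hu v hv huv
    obtain ⟨χ, w, hχ, hχu, hχv, -⟩ := hD.exists_colouring_reverseArc hT huv
    exact hf.arcSplits hT hu hv huv hχ hχu hχv (by simp)
  rw [TournamentCode.viable, allArcs_iff]
  intro i hi j hj
  exact ⟨fun h => key _ hi _ (hj.trans hi) ((hf.arc_iff _ hi _ (hj.trans hi)).1 h),
    fun h => key _ (hj.trans hi) _ hi (hf.adj_of_not_arc hT hi (hj.trans hi) hj.ne' h)⟩

theorem IsCopy.of_mem_openArcs (hf : IsCopy D m N f) (hT : D.IsTournament) {a : ℕ × ℕ}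
    (ha : a ∈ openArcs m N) : a.1 < m ∧ a.2 < m ∧ D.Adj (f a.1) (f a.2) ∧
      ∀ x, (path m N a.2 a.1).testBit x = true →
        TournamentCode.arcSplits m N (triangles m N) a.1 a.2 (2 ^ x) = false := by
  have htwo := mem_foldBelow (Q := fun i => i < m ∧ ∃ j < i,
    a = (bif arc N i j then i else j, bif arc N i j then j else i) ∧
      ∀ x < m, (path m N a.2 a.1).testBit x = true →
        TournamentCode.arcSplits m N (triangles m N) a.1 a.2 (2 ^ x) = false)
      (fun i hi acc h => ?_) ha
  · obtain h | ⟨i, -, hi, j, hj, rfl, hx⟩ := htwo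
    · exact absurd h List.not_mem_nil
    have hjm := hj.trans hi
    have hx' : ∀ u v, (∀ x < m, (path m N v u).testBit x = true →
        TournamentCode.arcSplits m N (triangles m N) u v (2 ^ x) = false) →
        ∀ x, (path m N v u).testBit x = true →
        TournamentCode.arcSplits m N (triangles m N) u v (2 ^ x) = false :=
      fun u v h x hx => h x ((testBit_path ..).1 hx).1 hx
    cases hij : arc N i j <;> rw [hij] at hx
    · exact ⟨hjm, hi, hf.adj_of_not_arc hT hi hjm hj.ne' hij, hx' _ _ hx⟩
    · exact ⟨hi, hjm, (hf.arc_iff _ hi _ hjm).1 hij, hx' _ _ hx⟩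
  · refine (mem_foldBelow (Q := fun j =>
      a = (bif arc N i j then i else j, bif arc N i j then j else i) ∧
      ∀ x < m, (path m N a.2 a.1).testBit x = true →
        TournamentCode.arcSplits m N (triangles m N) a.1 a.2 (2 ^ x) = false)
      (fun j hj acc h => ?_) h).imp_right fun h => ⟨hi, h⟩
    simp only [force_eq] at h
    generalize (bif arc N i j then i else j) = u at h ⊢
    generalize (bif arc N i j then j else i) = v at h ⊢
    cases hany : anyBelow m fun x => bif bit (path m N v u) x then
      TournamentCode.arcSplits m N (triangles m N) u v (Nat.pow 2 x) else false
    · rw [hany, cond_false, List.mem_cons] at h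
      rcases h with rfl | h
      · refine Or.inr ⟨rfl, fun x hx hp => ?_⟩
        by_contra hc
        rw [Bool.not_eq_false] at hc
        rw [← Bool.not_eq_true, anyBelow_iff] at hany
        exact hany ⟨x, hx, by rw [bit_eq, hp]; exact hc⟩
      · exact Or.inl h
    · rw [hany] at h
      exact Or.inl h

theorem beq_of_ne {i j : ℕ} (h : i ≠ j) : Nat.beq i j = false := by
  rwa [← Bool.not_eq_true, Nat.beq_eq]

theorem testBit_extend {q x : ℕ} (hx : x < 8 * (m + 1)) : (extend m N q).testBit x =
    bif Nat.beq (x / 8) m then q.testBit (x % 8) else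
      bif Nat.beq (x % 8) m then !q.testBit (x / 8) else N.testBit x := by
  change (maskOf (8 * (m + 1)) _).testBit x = _
  rw [testBit_maskOf, decide_eq_true hx, Bool.true_and]
  simp only [bit_eq]
  rfl

theorem arc_extend {q i j : ℕ} (hi : i < m + 1) (hj : j < m + 1) (hm : m ≤ 7) :
    arc (extend m N q) i j = bif Nat.beq i m then q.testBit j else
      bif Nat.beq j m then !q.testBit i else arc N i j := by
  change bit _ (8 * i + j) = _
  rw [bit_eq, testBit_extend (by omega), show (8 * i + j) / 8 = i by omega,
    show (8 * i + j) % 8 = j by omega, arc, bit_eq]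
  rfl

/-- Any further vertex of a tournament that contains a copy of a code extends the copy. -/
theorem IsCopy.extend (hf : IsCopy D m N f) (hT : D.IsTournament) (hm : m ≤ 7) {w : V}
    (hw : ∀ i < m, f i ≠ w) : ∃ q < 2 ^ m, (∀ j < m, (q.testBit j = true ↔ D.Adj w (f j))) ∧
      IsCopy D (m + 1) (extend m N q) (Function.update f m w) := by
  classical
  refine ⟨maskOf m fun j => decide (D.Adj w (f j)), maskOf_lt _ _, ?_, ?_⟩
  · intro j hj
    simp [testBit_maskOf, hj]
  have hup : ∀ i < m, Function.update f m w i = f i :=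
    fun i hi => Function.update_of_ne hi.ne _ _
  have hupm : Function.update f m w m = w := Function.update_self _ _ _
  constructor
  · intro i hi j hj hij
    rcases Nat.lt_succ_iff_lt_or_eq.1 hi with hi | rfl <;>
      rcases Nat.lt_succ_iff_lt_or_eq.1 hj with hj | rfl
    · rw [hup i hi, hup j hj] at hij
      exact hf.inj i hi j hj hij
    · rw [hup i hi, hupm] at hij
      exact absurd hij (hw i hi)
    · rw [hup j hj, hupm] at hij
      exact absurd hij.symm (hw j hj)
    · rfl
  · intro i hi j hj
    rw [arc_extend hi hj hm]
    rcases Nat.lt_succ_iff_lt_or_eq.1 hi with hi | rfl <;>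
      rcases Nat.lt_succ_iff_lt_or_eq.1 hj with hj | rfl
    · have h1 : Nat.beq i m = false := beq_of_ne hi.ne
      have h2 : Nat.beq j m = false := beq_of_ne hj.ne
      rw [h1, h2, hup i hi, hup j hj]
      exact hf.arc_iff i hi j hj
    · have h1 : Nat.beq i j = false := beq_of_ne hi.ne
      have h2 : Nat.beq j j = true := by simp
      rw [h1, h2, hup i hi, hupm, hT.adj_iff (hw i hi)]
      simp [testBit_maskOf, hi]
    · have h1 : Nat.beq i i = true := by simp
      rw [h1, hup j hj, hupm]
      simp [testBit_maskOf, hj]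
    · have h1 : Nat.beq j j = true := by simp
      rw [h1, hupm]
      simpa [testBit_maskOf] using hT.1.1 w

/-- The tournament on `m` vertices coded by `N` is contained in `D`. -/
def Occurs (D : Digraph V) (m N : ℕ) : Prop := ∃ f, IsCopy D m N f

/-- The inductive step of the classification: a 2-dicolourable tournament that occurs in a
3-dicritical tournament has an extension in the list that occurs there too. -/
theorem IsCopy.exists_mem_extensions (hf : IsCopy D m N f) (hT : D.IsTournament)
    (hD : D.IsDicritical 3) (hm : m ≤ 7) (hcol : colourable m (arc N) = true) :
    ∃ N' ∈ extensions m N, Occurs D (m + 1) N' := by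
  cases ho : openArcs m N with
  | nil =>
    -- a copy that covers `D` would make `D` 2-dicolourable
    obtain ⟨w, hw⟩ : ∃ w, ∀ i < m, f i ≠ w := by
      by_contra hcon
      push Not at hcon
      choose g hgm hg using hcon
      obtain ⟨χ, hχ⟩ := colourable_iff.1 hcol
      refine hD.not_splitsTriangles hT (fun x => χ (g x)) fun x y z hxy hyz hzx => ?_
      refine hχ _ (hgm x) _ (hgm y) _ (hgm z) ?_ ?_ ?_ <;>
        rwa [hf.arc_iff _ (hgm _) _ (hgm _), hg, hg]
    obtain ⟨q, hq, -, hf'⟩ := hf.extend hT hm hw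
    refine ⟨_, ?_, _, hf'⟩
    rw [extensions, ho]
    refine mem_foldBelow_of_step (fun k l h => ?_) hq fun l => ?_
    · rw [force_eq]
      cases TournamentCode.viable (Nat.succ m) (TournamentCode.extend m N k)
      · exact h
      · exact List.mem_cons_of_mem _ h
    · rw [force_eq]
      rw [show TournamentCode.viable (Nat.succ m) (TournamentCode.extend m N q) = true from
        hf'.viable hT hD]
      exact List.mem_cons_self
  | cons a l =>
    obtain ⟨hu, hv, huv, hopen⟩ :=
      hf.of_mem_openArcs hT (ho ▸ List.mem_cons_self : a ∈ openArcs m N)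
    obtain ⟨χ, w, hχ, hχu, hχv, hχw, hvw, hwu⟩ := hD.exists_colouring_reverseArc hT huv
    -- as the arc is open, its witness `w` is not in the copy
    have hw : ∀ i < m, f i ≠ w := by
      rintro i hi rfl
      have h1 := hopen i ((hf.testBit_path_iff hT hv hu i).2 ⟨hi, hvw, hwu⟩)
      rw [hf.arcSplits hT hu hv huv hχ hχu hχv] at h1
      · exact Bool.noConfusion h1
      · intro l hl
        rw [Nat.testBit_two_pow, decide_eq_true_iff] at hl
        rw [← hl, hχw]
    obtain ⟨q, hq, hqw, hf'⟩ := hf.extend hT hm hw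
    have hup : ∀ i < m, Function.update f m w i = f i :=
      fun i hi => Function.update_of_ne hi.ne _ _
    have hqu : q.testBit a.1 = true := (hqw _ hu).2 hwu
    have hqv : q.testBit a.2 = false := by
      rw [← Bool.not_eq_true, hqw _ hv, ← hT.adj_iff (hw _ hv)]
      exact hvw
    refine ⟨_, ?_, _, hf'⟩
    rw [extensions, ho]
    refine mem_foldBelow_of_step (fun k l h => ?_) hq fun l => ?_
    · rw [force_eq]
      cases bit k a.1
      · exact h
      cases bit k a.2
      · cases TournamentCode.arcSplits (Nat.succ m) (TournamentCode.extend m N k)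
          (triangles (Nat.succ m) (TournamentCode.extend m N k)) a.1 a.2 (Nat.pow 2 m)
        · exact h
        cases TournamentCode.viable (Nat.succ m) (TournamentCode.extend m N k)
        · exact h
        · exact List.mem_cons_of_mem _ h
      · exact h
    · have h1 : TournamentCode.arcSplits (Nat.succ m) (TournamentCode.extend m N q)
          (triangles (Nat.succ m) (TournamentCode.extend m N q)) a.1 a.2 (Nat.pow 2 m) = true := by
        refine hf'.arcSplits hT (χ := χ) (by omega) (by omega) ?_ ?_ ?_ ?_ ?_
        · rwa [hup _ hu, hup _ hv]
        · rwa [hup _ hu, hup _ hv]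
        · rwa [hup _ hu]
        · rwa [hup _ hv]
        · intro i hi
          change (2 ^ m).testBit i = true at hi
          rw [Nat.testBit_two_pow, decide_eq_true_iff] at hi
          rw [← hi, Function.update_self, hχw]
      rw [force_eq, bit_eq, bit_eq, hqu, hqv, h1,
        show TournamentCode.viable (Nat.succ m) (TournamentCode.extend m N q) = true from
        hf'.viable hT hD]
      exact List.mem_cons_self

end Extensions

/-! ### The enumeration up to isomorphism -/

section Search

variable {V : Type u} {D : Digraph V} {m N : ℕ} {f : ℕ → V}

theorem agree_iff {P l : ℕ} {g : ℕ → ℕ} : agree P N l g = true ↔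
    ∀ j < l + 1, arc P l j = arc N (g l) (g j) ∧ arc P j l = arc N (g j) (g l) := by
  rw [agree, allBelow_iff]
  refine forall₂_congr fun j _ => ?_
  cases arc P l j <;> cases arc N (g l) (g j) <;> cases arc P j l <;>
    cases arc N (g j) (g l) <;> simp

theorem of_embedsFrom {P : ℕ} (k l : ℕ) (g : ℕ → ℕ) (h : embedsFrom m P N k l g = true)
    (hlt : ∀ i < l, g i < m) (hinj : ∀ i < l, ∀ j < l, g i = g j → i = j)
    (harc : ∀ i < l, ∀ j < l, arc P i j = arc N (g i) (g j)) :
    ∃ g' : ℕ → ℕ, (∀ i < l + k, g' i < m) ∧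
      (∀ i < l + k, ∀ j < l + k, g' i = g' j → i = j) ∧
      ∀ i < l + k, ∀ j < l + k, arc P i j = arc N (g' i) (g' j) := by
  induction k generalizing l g with
  | zero => exact ⟨g, hlt, hinj, harc⟩
  | succ k ih =>
    change (anyBelow m fun x =>
      bif (bif Nat.beq (score m P l) (score m N x) then anyBelow l fun j => Nat.beq (g j) x
        else true) then false else
        (fun g' : ℕ → ℕ => bif agree P N l g' then embedsFrom m P N k (Nat.succ l) g' else false)
          fun j => bif Nat.beq j l then x else g j) = true at h
    -- `x` is the image of the vertex `l`
    obtain ⟨x, hx, h⟩ := anyBelow_iff.1 h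
    set g' : ℕ → ℕ := fun j => bif Nat.beq j l then x else g j with hg'
    cases hs : Nat.beq (score m P l) (score m N x)
    · simp [hs] at h
    cases hn : anyBelow l fun j => Nat.beq (g j) x
    swap
    · simp [hs, hn] at h
    cases ha : agree P N l g'
    · simp [hs, hn, ha] at h
    simp only [hs, hn, ha, cond_true, cond_false] at h
    have hnew : ∀ j < l, g j ≠ x := by
      intro j hj e
      rw [← Bool.not_eq_true, anyBelow_iff] at hn
      exact hn ⟨j, hj, by simp [e]⟩
    have hl : g' l = x := by simp [hg']
    have hold : ∀ j < l, g' j = g j := fun j hj => by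
      simp only [hg', beq_of_ne hj.ne, cond_false]
    rw [agree_iff] at ha
    have hlt' : ∀ i < l + 1, g' i < m := by
      intro i hi
      rcases Nat.lt_succ_iff_lt_or_eq.1 hi with hi | rfl
      · rw [hold i hi]; exact hlt i hi
      · rw [hl]; exact hx
    have hinj' : ∀ i < l + 1, ∀ j < l + 1, g' i = g' j → i = j := by
      intro i hi j hj hij
      rcases Nat.lt_succ_iff_lt_or_eq.1 hi with hi | rfl <;>
        rcases Nat.lt_succ_iff_lt_or_eq.1 hj with hj | rfl
      · rw [hold i hi, hold j hj] at hij
        exact hinj i hi j hj hij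
      · rw [hold i hi, hl] at hij
        exact absurd hij (hnew i hi)
      · rw [hold j hj, hl] at hij
        exact absurd hij.symm (hnew j hj)
      · rfl
    have harc' : ∀ i < l + 1, ∀ j < l + 1, arc P i j = arc N (g' i) (g' j) := by
      intro i hi j hj
      rcases Nat.lt_succ_iff_lt_or_eq.1 hi with hi' | rfl
      · rcases Nat.lt_succ_iff_lt_or_eq.1 hj with hj' | rfl
        · rw [hold i hi', hold j hj']
          exact harc i hi' j hj'
        · exact (ha i hi).2
      · exact (ha j hj).1
    obtain ⟨g'', hg''⟩ := ih (l + 1) g' h hlt' hinj' harc'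
    rw [show l + 1 + k = l + (k + 1) by omega] at hg''
    exact ⟨g'', hg''⟩

theorem Occurs.of_embeds {P : ℕ} (hN : Occurs D m N) (h : embeds m P N = true) :
    Occurs D m P := by
  obtain ⟨f, hf⟩ := hN
  obtain ⟨g, h1, h2, h3⟩ := of_embedsFrom m 0 (fun _ => 0) h (by simp) (by simp) (by simp)
  rw [Nat.zero_add] at h1 h2 h3
  refine ⟨f ∘ g, fun i hi j hj hij => h2 i hi j hj (hf.inj _ (h1 i hi) _ (h1 j hj) hij), ?_⟩
  intro i hi j hj
  rw [h3 i hi j hj]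
  exact hf.arc_iff _ (h1 i hi) _ (h1 j hj)

theorem mem_insertCode_of_mem {P : ℕ} {l : List ℕ} (h : P ∈ l) : P ∈ insertCode m N l := by
  simp only [insertCode, force_eq, Bool.cond_eq_ite]
  split_ifs
  exacts [h, List.mem_cons_of_mem _ h]

theorem Occurs.exists_mem_insertCode (hN : Occurs D m N) (l : List ℕ) :
    ∃ P ∈ insertCode m N l, Occurs D m P := by
  simp only [insertCode, force_eq, Bool.cond_eq_ite]
  split_ifs with h
  · obtain ⟨P, hP, h⟩ := List.any_eq_true.1 h
    split_ifs at h
    exact ⟨P, hP, hN.of_embeds h⟩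
  · exact ⟨N, List.mem_cons_self, hN⟩

/-- One of the two tournaments of the classification is contained in `D`. -/
def ContainsTarget (D : Digraph V) : Prop :=
  Occurs D 7 rotativeCode ∨ Occurs D 7 paleyCode

theorem Occurs.containsTarget (hN : Occurs D m N) (h : isTarget m N = true) :
    ContainsTarget D := by
  simp only [isTarget, Bool.cond_eq_ite] at h
  split_ifs at h with h1 h2
  · obtain rfl : m = 7 := by simpa using h1
    exact Or.inl (hN.of_embeds h2)
  · obtain rfl : m = 7 := by simpa using h1
    exact Or.inr (hN.of_embeds h)

theorem mem_insertAll_of_mem {P : ℕ} {acc : List ℕ} (h : P ∈ acc) (l : List ℕ) :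
    P ∈ insertAll m l acc := by
  induction l with
  | nil => exact h
  | cons N l ih =>
    change P ∈ bif isTarget m N then insertAll m l acc else insertCode m N (insertAll m l acc)
    cases isTarget m N
    exacts [mem_insertCode_of_mem ih, ih]

theorem Occurs.exists_mem_insertAll (hN : Occurs D m N) {l : List ℕ} (h : N ∈ l) (acc : List ℕ) :
    ContainsTarget D ∨ ∃ P ∈ insertAll m l acc, Occurs D m P := by
  induction l with
  | nil => exact absurd h List.not_mem_nil
  | cons M l ih =>
    change _ ∨ ∃ P ∈ bif isTarget m M then insertAll m l acc
      else insertCode m M (insertAll m l acc), _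
    cases hM : isTarget m M
    · rcases List.mem_cons.1 h with rfl | h
      · exact Or.inr (hN.exists_mem_insertCode _)
      · exact (ih h).imp_right fun ⟨P, hP, hocc⟩ => ⟨P, mem_insertCode_of_mem hP, hocc⟩
    · rcases List.mem_cons.1 h with rfl | h
      · exact Or.inl (hN.containsTarget hM)
      · exact ih h

theorem Occurs.exists_mem_step (hT : D.IsTournament) (hD : D.IsDicritical 3) (hm : m ≤ 7)
    (hN : Occurs D m N) (hcol : colourable m (arc N) = true) {l : List ℕ} (h : N ∈ l) :
    ContainsTarget D ∨ ∃ P ∈ step m l, Occurs D (m + 1) P := by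
  induction l with
  | nil => exact absurd h List.not_mem_nil
  | cons M l ih =>
    change _ ∨ ∃ P ∈ insertAll (m + 1) (extensions m M) (step m l), _
    rcases List.mem_cons.1 h with rfl | h
    · obtain ⟨f, hf⟩ := hN
      obtain ⟨N', hN', hocc⟩ := hf.exists_mem_extensions hT hD hm hcol
      exact hocc.exists_mem_insertAll hN' _
    · exact (ih h).imp_right fun ⟨P, hP, hocc⟩ => ⟨P, mem_insertAll_of_mem hP _, hocc⟩

theorem containsTarget_of_exhausted (hT : D.IsTournament) (hD : D.IsDicritical 3) (n : ℕ)
    {m : ℕ} {l : List ℕ} (hmn : m + n ≤ 8) (h : exhausted n m l = true)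
    (hl : ∃ N ∈ l, Occurs D m N) : ContainsTarget D := by
  induction n generalizing m l with
  | zero =>
    obtain ⟨N, hN, -⟩ := hl
    change l.isEmpty = true at h
    rw [List.isEmpty_iff] at h
    exact absurd (h ▸ hN) List.not_mem_nil
  | succ n ih =>
    change (bif l.all fun N => colourable m (arc N) then exhausted n (m + 1) (step m l)
      else false) = true at h
    rw [Bool.cond_false_right, Bool.and_eq_true, List.all_eq_true] at h
    obtain ⟨N, hN, hocc⟩ := hl
    exact (hocc.exists_mem_step hT hD (by omega) (h.1 N hN) hN).elim id (ih (by omega) h.2)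

/-- The enumeration starts from the empty tournament and ends on eight vertices. -/
theorem exhausted_eight : exhausted 8 0 [0] = true := by
  decide +kernel

theorem containsTarget (hT : D.IsTournament) (hD : D.IsDicritical 3) : ContainsTarget D := by
  have : Nonempty V := by
    by_contra hV
    rw [not_nonempty_iff] at hV
    exact hD.not_splitsTriangles hT (fun _ => true) fun x => hV.elim x
  exact containsTarget_of_exhausted hT hD 8 le_rfl exhausted_eight
    ⟨0, List.mem_cons_self, fun _ => Classical.arbitrary V, by simp, by simp⟩

end Search

/-! ### Recognition of critical tournaments -/

section Targets

variable {V : Type u} {W : Type v} {D : Digraph V} {E : Digraph W} {m N : ℕ} {f : ℕ → V}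

theorem IsCopy.isDicritical (hf : IsCopy D m N f) (hT : D.IsTournament)
    (hs : ∀ x, ∃ i < m, f i = x) (hm : 2 ≤ m) (hc : isCritical m N = true) :
    D.IsDicritical 3 := by
  simp only [isCritical, Bool.cond_eq_ite] at hc
  split_ifs at hc with hcol
  rw [allArcs_iff] at hc
  have key : ∀ u < m, ∀ v < m, colourable m (reversed N u v) = true →
      ∃ χ, (D.reverseArc (f u) (f v)).SplitsTriangles χ := by
    intro u hu v hv h
    obtain ⟨χ, hχ⟩ := colourable_iff.1 h
    choose g hgm hg using hs
    refine ⟨fun x => χ (g x), fun x y z hxy hyz hzx => ?_⟩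
    have hgf : ∀ i < m, g (f i) = i := fun i hi => hf.inj _ (hgm _) _ hi (hg _)
    have hrev : ∀ x y, (D.reverseArc (f u) (f v)).Adj x y → reversed N u v (g x) (g y) = true := by
      rintro x y (⟨h1, h2⟩ | ⟨rfl, rfl⟩)
      · have h3 : ¬ (g x = u ∧ g y = v) := by
          rintro ⟨rfl, rfl⟩
          exact h2 ⟨(hg x).symm, (hg y).symm⟩
        have h4 : arc N (g x) (g y) = true := by
          rwa [hf.arc_iff _ (hgm _) _ (hgm _), hg, hg]
        simp only [reversed, Bool.cond_eq_ite, h4]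
        split_ifs <;> simp_all
      · simp [reversed, hgf _ hu, hgf _ hv]
    exact hχ _ (hgm x) _ (hgm y) _ (hgm z) (hrev _ _ hxy) (hrev _ _ hyz) (hrev _ _ hzx)
  refine hT.isDicritical ?_ ?_ ?_
  · intro χ hχ
    refine hcol (colourable_iff.2 ⟨fun i => χ (f i), fun i hi j hj k hk hij hjk hki => ?_⟩)
    exact hχ _ _ _ ((hf.arc_iff i hi j hj).1 hij) ((hf.arc_iff j hj k hk).1 hjk)
      ((hf.arc_iff k hk i hi).1 hki)
  · intro x
    by_contra hcon
    push Not at hcon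
    have h := hf.inj 0 (by omega) 1 (by omega) ((hcon _).trans (hcon _).symm)
    omega
  · intro x y hxy
    obtain ⟨i, hi, rfl⟩ := hs x
    obtain ⟨j, hj, rfl⟩ := hs y
    have harc := (hf.arc_iff i hi j hj).2 hxy
    rcases lt_trichotomy j i with h | rfl | h
    · exact key i hi j hj ((hc i hi j h).1 harc)
    · exact absurd hxy (hT.1.1 _)
    · refine key i hi j hj ((hc j hj i h).2 ?_)
      by_contra hcon
      rw [Bool.not_eq_false, hf.arc_iff j hj i hi] at hcon
      exact hT.2 ⟨_, _, fun e => hT.1.1 _ (e ▸ hxy), hxy, hcon⟩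

/-- A copy of a tournament that is not 2-dicolourable covers every 3-dicritical tournament. -/
theorem IsCopy.surjective (hf : IsCopy D m N f) (hT : D.IsTournament) (hD : D.IsDicritical 3)
    (hcol : colourable m (arc N) = false) (x : V) : ∃ i < m, f i = x := by
  by_contra hcon
  push Not at hcon
  obtain ⟨χ, hχ⟩ := hD.exists_colouring_delete_vertex hT x
  rw [← Bool.not_eq_true, colourable_iff] at hcol
  refine hcol ⟨fun i => χ (f i), fun i hi j hj k hk hij hjk hki => ?_⟩
  exact hχ _ _ _ (hcon i hi) (hcon j hj) (hcon k hk) ((hf.arc_iff i hi j hj).1 hij)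
    ((hf.arc_iff j hj k hk).1 hjk) ((hf.arc_iff k hk i hi).1 hki)

theorem IsCopy.nonempty_iso (hf : IsCopy D m N f) (hs : ∀ x, ∃ i < m, f i = x) {g : ℕ → W}
    (hg : IsCopy E m N g) (hgs : ∀ x, ∃ i < m, g i = x) : Nonempty (D.Iso E) := by
  have hbf : Function.Bijective fun i : Fin m => f i :=
    ⟨fun i j h => Fin.ext (hf.inj i i.2 j j.2 h), fun x => by
      obtain ⟨i, hi, rfl⟩ := hs x
      exact ⟨⟨i, hi⟩, rfl⟩⟩
  have hbg : Function.Bijective fun i : Fin m => g i :=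
    ⟨fun i j h => Fin.ext (hg.inj i i.2 j j.2 h), fun x => by
      obtain ⟨i, hi, rfl⟩ := hgs x
      exact ⟨⟨i, hi⟩, rfl⟩⟩
  let e := (Equiv.ofBijective _ hbf).symm.trans (Equiv.ofBijective _ hbg)
  refine ⟨⟨e, fun {x y} => ?_⟩⟩
  obtain ⟨i, rfl⟩ := (Equiv.ofBijective _ hbf).surjective x
  obtain ⟨j, rfl⟩ := (Equiv.ofBijective _ hbf).surjective y
  simp only [e, Equiv.trans_apply, Equiv.symm_apply_apply]
  exact (hg.arc_iff i i.2 j j.2).symm.trans (hf.arc_iff i i.2 j j.2)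

end Targets

/-! ### The rotative tournament and the Paley tournament -/

section Rotative

theorem rotativeAdj_iff {V : Type u} {W : Type v} (H₁ : Digraph V) (H₂ : Digraph W)
    (x y : Option (V ⊕ W)) : (H₁.rotative H₂).Adj x y ↔
      match x, y with
      | none, some (Sum.inl _) => True
      | some (Sum.inl a), some (Sum.inl b) => H₁.Adj a b
      | some (Sum.inl _), some (Sum.inr _) => True
      | some (Sum.inr a), some (Sum.inr b) => H₂.Adj a b
      | some (Sum.inr _), none => True
      | _, _ => False := by
  constructor
  · rintro (_ | _ | _ | _ | _) <;> trivial
  · rcases x with _ | a | a <;> rcases y with _ | b | b <;> intro h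
    · exact h.elim
    · exact .root_left b
    · exact h.elim
    · exact h.elim
    · exact .left h
    · exact .left_right a b
    · exact .right_root a
    · exact h.elim
    · exact .right h

instance : DecidableRel (directedCycle 3).Adj := fun i j =>
  inferInstanceAs (Decidable (j = i + 1))

instance : DecidableRel ((directedCycle 3).rotative (directedCycle 3)).Adj := fun x y => by
  refine @decidable_of_iff' _ _ (rotativeAdj_iff _ _ x y) ?_
  rcases x with _ | a | a <;> rcases y with _ | b | b <;> dsimp only <;> infer_instance

instance : DecidableRel paleySeven.Adj := fun i j =>
  inferInstanceAs (Decidable (j - i ≠ 0 ∧ ∃ r, j - i = r * r))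

/-- The vertex of the rotative digraph of two directed triangles with the number `i` in
`rotativeCode`. -/
def rotativeVertex (i : ℕ) : Option (ZMod 3 ⊕ ZMod 3) :=
  if i = 0 then none else if i < 4 then some (Sum.inl i) else some (Sum.inr i)

theorem isCopy_rotative :
    IsCopy ((directedCycle 3).rotative (directedCycle 3)) 7 rotativeCode rotativeVertex :=
  ⟨by decide +kernel, by decide +kernel⟩

theorem isCopy_paley : IsCopy paleySeven 7 paleyCode (fun i => (i : ZMod 7)) :=
  ⟨by decide +kernel, by decide +kernel⟩

theorem exists_rotativeVertex (x : Option (ZMod 3 ⊕ ZMod 3)) : ∃ i < 7, rotativeVertex i = x := by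
  revert x
  decide +kernel

theorem exists_paleyVertex (x : ZMod 7) : ∃ i : ℕ, i < 7 ∧ (i : ZMod 7) = x := by
  revert x
  decide +kernel

theorem isTournament_rotative :
    ((directedCycle 3).rotative (directedCycle 3)).IsTournament := by
  refine ⟨⟨?_, ?_⟩, ?_⟩
  · unfold Loopless; decide +kernel
  · decide +kernel
  · unfold HasDigon; decide +kernel

theorem isTournament_paley : paleySeven.IsTournament := by
  refine ⟨⟨?_, ?_⟩, ?_⟩
  · unfold Loopless; decide +kernel
  · decide +kernel
  · unfold HasDigon; decide +kernel

theorem isCritical_rotativeCode : isCritical 7 rotativeCode = true := by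
  decide +kernel

theorem isCritical_paleyCode : isCritical 7 paleyCode = true := by
  decide +kernel

/-- A vertex of the first triangle of the rotative tournament has four out-neighbours, while the
vertices of the Paley tournament have three. -/
theorem not_nonempty_iso_rotative_paley :
    ¬ Nonempty (((directedCycle 3).rotative (directedCycle 3)).Iso paleySeven) := by
  rintro ⟨e⟩
  have hR : (Finset.univ.filter
      (((directedCycle 3).rotative (directedCycle 3)).Adj (some (Sum.inl 0)))).card = 4 := by
    decide +kernel
  have hP : ∀ a : ZMod 7, (Finset.univ.filter (paleySeven.Adj a)).card = 3 := by
    decide +kernel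
  have h := Finset.card_map (s := Finset.univ.filter
    (((directedCycle 3).rotative (directedCycle 3)).Adj (some (Sum.inl 0)))) e.toEquiv.toEmbedding
  have hsub : (Finset.univ.filter (((directedCycle 3).rotative (directedCycle 3)).Adj
      (some (Sum.inl 0)))).map e.toEquiv.toEmbedding ⊆
      Finset.univ.filter (paleySeven.Adj (e (some (Sum.inl 0)))) := by
    intro y hy
    obtain ⟨x, hx, rfl⟩ := Finset.mem_map.1 hy
    rw [Finset.mem_filter] at hx ⊢
    exact ⟨Finset.mem_univ _, e.map_rel_iff.2 hx.2⟩
  have := Finset.card_le_card hsub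
  rw [h, hR, hP] at this
  omega

theorem nonempty_iso_or_nonempty_iso {V : Type u} {D : Digraph V} (hT : D.IsTournament)
    (hD : D.IsDicritical 3) :
    Nonempty (D.Iso ((directedCycle 3).rotative (directedCycle 3))) ∨
      Nonempty (D.Iso paleySeven) := by
  have hcol : ∀ N, isCritical 7 N = true → colourable 7 (arc N) = false := by
    intro N h
    by_contra hc
    rw [Bool.not_eq_false] at hc
    rw [isCritical, hc] at h
    exact Bool.noConfusion h
  refine (containsTarget hT hD).imp ?_ ?_
  · rintro ⟨f, hf⟩
    exact hf.nonempty_iso (hf.surjective hT hD (hcol _ isCritical_rotativeCode)) isCopy_rotative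
      exists_rotativeVertex
  · rintro ⟨f, hf⟩
    exact hf.nonempty_iso (hf.surjective hT hD (hcol _ isCritical_paleyCode)) isCopy_paley
      exists_paleyVertex

theorem isDicritical_rotative :
    ((directedCycle 3).rotative (directedCycle 3)).IsDicritical 3 :=
  isCopy_rotative.isDicritical isTournament_rotative exists_rotativeVertex (by norm_num)
    isCritical_rotativeCode

theorem isDicritical_paley : paleySeven.IsDicritical 3 :=
  isCopy_paley.isDicritical isTournament_paley exists_paleyVertex (by norm_num)
    isCritical_paleyCode

end Rotative

end TournamentCode

theorem mainTheorem3 :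
    (((Digraph.directedCycle 3).rotative (Digraph.directedCycle 3)).IsTournament ∧
      ((Digraph.directedCycle 3).rotative (Digraph.directedCycle 3)).IsDicritical 3) ∧
    (Digraph.paleySeven.IsTournament ∧ Digraph.paleySeven.IsDicritical 3) ∧
    (¬ Nonempty (((Digraph.directedCycle 3).rotative (Digraph.directedCycle 3)).Iso
      Digraph.paleySeven)) ∧
    (∀ (V : Type*) [Finite V] (D : Digraph V), D.IsTournament → D.IsDicritical 3 →
      Nonempty (D.Iso ((Digraph.directedCycle 3).rotative (Digraph.directedCycle 3))) ∨
      Nonempty (D.Iso Digraph.paleySeven)) := by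
  exact ⟨⟨TournamentCode.isTournament_rotative, TournamentCode.isDicritical_rotative⟩,
    ⟨TournamentCode.isTournament_paley, TournamentCode.isDicritical_paley⟩,
    TournamentCode.not_nonempty_iso_rotative_paley,
    fun _ _ _ hT hD => TournamentCode.nonempty_iso_or_nonempty_iso hT hD⟩
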